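/- For $a,b\in\mathbb{Z}[[q]]$ with $b$ of zero constant term, write $(a;b)_\infty=\prod_{n\ge0}(1-ab^n)$ and $(a_1,a_2;b)_\infty=(a_1;b)_\infty(a_2;b)_\infty$, as formal power series in $q$. Define the integers $g_1(n)$ and $h_1(n)$, $n\ge0$, by $$\sum_{n=0}^{\infty}g_1(n)q^n=(-q,-q^4;q^5)_\infty^2\,(q^4,q^6;q^{10})_\infty,\qquad \sum_{n=0}^{\infty}h_1(n)q^n=(-q^2,-q^3;q^5)_\infty^2\,(q^2,q^8;q^{10})_\infty .$$ Then for every integer $n\ge0$, $$g_1(5n)=h_1(5n)\qquad\text{and}\qquad g_1(5n+4)=-h_1(5n+4).$$ -/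

import Mathlib

open PowerSeries
open scoped PowerSeries.WithPiTopology

namespace QSeries

/-- The q-Pochhammer symbol `(a; b)_∞ = ∏_{n ≥ 0} (1 - a * b ^ n)` as a formal power series in
the variable `q = X` over `ℤ`. The product is taken in the topology of coefficientwise
convergence (the coefficients `ℤ` being discrete). -/
noncomputable def qPoch (a b : ℤ⟦X⟧) : ℤ⟦X⟧ :=
  ∏' n : ℕ, (1 - a * b ^ n)

/-- The infinite product `(a; b)_∞` converges whenever `b` has zero constant term. -/
theorem multipliable_qPoch (a : ℤ⟦X⟧) {b : ℤ⟦X⟧} (hb : constantCoeff b = 0) :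
    Multipliable fun n : ℕ => (1 - a * b ^ n) := by
  have h : Multipliable fun n : ℕ => (1 + -(a * b ^ n)) := by
    apply PowerSeries.WithPiTopology.multipliable_one_add_of_tendsto_order_atTop_nhds_top
    rw [ENat.tendsto_nhds_top_iff_natCast_lt]
    intro m
    filter_upwards [Filter.eventually_gt_atTop m] with n hn
    rw [PowerSeries.order_neg]
    have h1 : (n : ℕ∞) ≤ (b ^ n).order := by
      apply PowerSeries.le_order_pow_of_constantCoeff_eq_zero n hb
    have h2 : (b ^ n).order ≤ (a * b ^ n).order :=
      le_trans le_add_self (PowerSeries.le_order_mul (φ := a) (ψ := b ^ n))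
    exact lt_of_lt_of_le (by exact_mod_cast hn) (h1.trans h2)
  simpa only [sub_eq_add_neg] using h

/-- The multi-parameter symbol `(a, c; b)_∞ = (a; b)_∞ (c; b)_∞`. -/
noncomputable def qPoch₂ (a c b : ℤ⟦X⟧) : ℤ⟦X⟧ :=
  qPoch a b * qPoch c b

/-- `g₁(n)` is the coefficient of `q ^ n` in `(-q, -q⁴; q⁵)_∞² (q⁴, q⁶; q¹⁰)_∞`. -/
noncomputable def g₁ (n : ℕ) : ℤ :=
  coeff n (qPoch₂ (-X) (-X ^ 4) (X ^ 5) ^ 2 * qPoch₂ (X ^ 4) (X ^ 6) (X ^ 10))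

/-- `h₁(n)` is the coefficient of `q ^ n` in `(-q², -q³; q⁵)_∞² (q², q⁸; q¹⁰)_∞`. -/
noncomputable def h₁ (n : ℕ) : ℤ :=
  coeff n (qPoch₂ (-X ^ 2) (-X ^ 3) (X ^ 5) ^ 2 * qPoch₂ (X ^ 2) (X ^ 8) (X ^ 10))

end QSeries

namespace QSeries

/-! Multiply both generating functions by $P=(q^5;q^5)_\infty^2(q^{10};q^{10})_\infty$. By the
Jacobi triple product each becomes a product of three theta series, so its coefficient at $q^N$ is
the sum of $(-1)^k$ over integer points $(i,j,k)$ with $5(i^2+j^2)-3(i+j)+10k^2-2k=2N$ for $g_1$,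
and $5(i^2+j^2)-(i+j)+10k^2-6k=2N$ for $h_1$. These are ellipsoids of one form $i^2+j^2+2k^2$,
centred at $(3,3,1)/10$ and $(1,1,3)/10$. A rational isometry with denominator 5 carries one to the
other; for $N\equiv0,4\pmod 5$ it, or its composite with the point reflection in the new centre,
maps integer points to integer points bijectively, keeping or flipping $(-1)^k$. As $P$ is a series
in $q^5$ with constant term 1, it can be divided out within a residue class mod 5
(`coeff_eq_zero_of_coeff_mul_eq_zero`). -/

/-- The triangular number `i (i + 1) / 2` of an integer, as a natural number. -/
def tri (i : ℤ) : ℕ := (i * (i + 1) / 2).toNat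

theorem two_mul_tri (i : ℤ) : 2 * (tri i : ℤ) = i * (i + 1) := by
  have h0 : 0 ≤ i * (i + 1) := by
    rcases le_or_gt 0 i with h | h
    · positivity
    · nlinarith
  have h2 : 2 * (i * (i + 1) / 2) = i * (i + 1) :=
    Int.mul_ediv_cancel' (Int.even_mul_succ_self i).two_dvd
  rw [tri, Int.toNat_of_nonneg (by omega), h2]

theorem tri_add_tri_sub_one (i : ℤ) : ((tri i + tri (i - 1) : ℕ) : ℤ) = i ^ 2 := by
  have h1 := two_mul_tri i
  have h2 := two_mul_tri (i - 1)
  push_cast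
  linarith

/-! ### Gaussian binomials and the finite triple product -/

section GaussBinom

variable {R : Type*} [CommRing R]

/-- The Gaussian binomial coefficient with base `b`. -/
def gaussBinom (b : R) : ℕ → ℕ → R
  | _, 0 => 1
  | 0, _ + 1 => 0
  | n + 1, k + 1 => gaussBinom b n k + b ^ (k + 1) * gaussBinom b n (k + 1)

@[simp] theorem gaussBinom_zero_right (b : R) (n : ℕ) : gaussBinom b n 0 = 1 := by
  cases n <;> rfl

theorem gaussBinom_succ_succ (b : R) (n k : ℕ) :
    gaussBinom b (n + 1) (k + 1) = gaussBinom b n k + b ^ (k + 1) * gaussBinom b n (k + 1) := rfl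

theorem gaussBinom_eq_zero_of_lt (b : R) {n k : ℕ} (h : n < k) : gaussBinom b n k = 0 := by
  induction n generalizing k with
  | zero => obtain ⟨k, rfl⟩ := Nat.exists_eq_succ_of_ne_zero h.ne'; rfl
  | succ n ih =>
    obtain ⟨k, rfl⟩ := Nat.exists_eq_succ_of_ne_zero (Nat.ne_zero_of_lt h)
    rw [Nat.succ_eq_add_one, gaussBinom_succ_succ, ih (by omega), ih (by omega)]
    simp

@[simp] theorem gaussBinom_self (b : R) (n : ℕ) : gaussBinom b n n = 1 := by
  induction n with
  | zero => rfl
  | succ n ih => rw [gaussBinom_succ_succ, ih, gaussBinom_eq_zero_of_lt b (Nat.lt_succ_self n)]; simp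

/-- The factorial formula for Gaussian binomial coefficients. -/
theorem gaussBinom_mul_prod_mul_prod (b : R) (p r : ℕ) :
    gaussBinom b (p + r) p * (∏ j ∈ Finset.range p, (1 - b * b ^ j)) *
      ∏ j ∈ Finset.range r, (1 - b * b ^ j) = ∏ j ∈ Finset.range (p + r), (1 - b * b ^ j) := by
  induction p generalizing r with
  | zero => simp
  | succ p ihp =>
    induction r with
    | zero => simp
    | succ r ihr =>
      have h1 := ihp (r + 1)
      rw [show p + 1 + (r + 1) = p + (r + 1) + 1 by ring, gaussBinom_succ_succ,
        Finset.prod_range_succ _ (p + (r + 1)), ← h1]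
      rw [show p + 1 + r = p + (r + 1) by ring] at ihr
      rw [← h1] at ihr
      rw [Finset.prod_range_succ _ r, Finset.prod_range_succ _ p] at *
      linear_combination (b ^ (p + 1) * (1 - b * b ^ r)) * ihr

/-- The finite `q`-binomial theorem. -/
theorem prod_add_mul_pow_eq_sum_gaussBinom (b u v : R) (n : ℕ) :
    ∏ j ∈ Finset.range n, (u + v * b ^ j) =
      ∑ k ∈ Finset.range (n + 1), gaussBinom b n k * b ^ (k.choose 2) * v ^ k * u ^ (n - k) := by
  induction n generalizing v with
  | zero => simp
  | succ n ih =>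
    have h : ∏ j ∈ Finset.range (n + 1), (u + v * b ^ j) =
        (u + v) * ∏ j ∈ Finset.range n, (u + v * b * b ^ j) := by
      rw [Finset.prod_range_succ', mul_comm]
      simp [pow_succ', mul_assoc]
    rw [h, ih, add_mul, Finset.mul_sum, Finset.mul_sum, Finset.sum_range_succ' _ (n + 1),
      Finset.sum_range_succ' _ n, add_right_comm]
    congr 1
    · have h0 : ∑ k ∈ Finset.range n, u * (gaussBinom b n (k + 1) * b ^ ((k + 1).choose 2) *
          (v * b) ^ (k + 1) * u ^ (n - (k + 1))) =
          ∑ k ∈ Finset.range (n + 1), gaussBinom b n (k + 1) * b ^ ((k + 1).choose 2) *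
          (v * b) ^ (k + 1) * u ^ (n - k) := by
        rw [Finset.sum_range_succ, gaussBinom_eq_zero_of_lt b (Nat.lt_succ_self n)]
        simp only [zero_mul, add_zero]
        refine Finset.sum_congr rfl fun k hk => ?_
        rw [show n - k = n - (k + 1) + 1 by have := Finset.mem_range.1 hk; omega]
        ring
      rw [h0, ← Finset.sum_add_distrib]
      refine Finset.sum_congr rfl fun k _ => ?_
      rw [gaussBinom_succ_succ, Nat.choose_succ_succ' k 1, Nat.choose_one_right,
        Nat.add_sub_add_right]
      ring
    · simp [pow_succ']

/-- A finite form of the Jacobi triple product identity. -/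
theorem prod_mul_prod_eq_sum_gaussBinom [IsDomain R] {x y : R} (hx : x ≠ 0) (hy : y ≠ 0) (m : ℕ) :
    (∏ j ∈ Finset.range m, (1 + x * (x * y) ^ j)) * ∏ j ∈ Finset.range m, (1 + y * (x * y) ^ j) =
      ∑ i ∈ Finset.Icc (-m : ℤ) m,
        gaussBinom (x * y) (2 * m) (m + i).toNat * (x ^ tri i * y ^ tri (i - 1)) := by
  -- The $q$-binomial theorem is used with $2m$ factors, $u=(xy)^m$, $v=x$. The lower half of the
  -- factors, reversed, gives the $y$-product and the upper half the $x$-product; this monomial is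
  -- what they shed.
  have hc : x ^ m * (x * y) ^ (m.choose 2 + m * m) ≠ 0 := by positivity
  apply mul_left_cancel₀ hc
  have h1 : ∏ j ∈ Finset.range (2 * m), ((x * y) ^ m + x * (x * y) ^ j) =
      x ^ m * (x * y) ^ (m.choose 2 + m * m) * ((∏ j ∈ Finset.range m, (1 + x * (x * y) ^ j)) *
        ∏ j ∈ Finset.range m, (1 + y * (x * y) ^ j)) := by
    have h2 : ∏ j ∈ Finset.range m, ((x * y) ^ m + x * (x * y) ^ j) =
        x ^ m * (x * y) ^ m.choose 2 * ∏ j ∈ Finset.range m, (1 + y * (x * y) ^ j) := by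
      clear hc
      induction m with
      | zero => simp
      | succ m ih =>
        have h3 : ∀ j, (x * y) ^ (m + 1) + x * (x * y) ^ (j + 1) =
            x * y * ((x * y) ^ m + x * (x * y) ^ j) := fun j => by ring
        rw [Finset.prod_range_succ', Finset.prod_congr rfl fun j _ => h3 j,
          Finset.prod_mul_distrib, Finset.prod_const, Finset.card_range, ih,
          Finset.prod_range_succ, Nat.choose_succ_succ' m 1, Nat.choose_one_right]
        ring
    rw [two_mul, Finset.prod_range_add, h2]
    have h3 : ∏ j ∈ Finset.range m, ((x * y) ^ m + x * (x * y) ^ (m + j)) =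
        (x * y) ^ (m * m) * ∏ j ∈ Finset.range m, (1 + x * (x * y) ^ j) := by
      have h4 : ∀ j, (x * y) ^ m + x * (x * y) ^ (m + j) =
          (x * y) ^ m * (1 + x * (x * y) ^ j) := fun j => by ring
      rw [Finset.prod_congr rfl fun j _ => h4 j, Finset.prod_mul_distrib, Finset.prod_const,
        Finset.card_range, pow_mul]
    rw [h3]
    ring
  rw [← h1, prod_add_mul_pow_eq_sum_gaussBinom, Finset.mul_sum]
  refine Finset.sum_bij' (fun k _ => (k : ℤ) - m) (fun i _ => (m + i).toNat) ?_ ?_ ?_ ?_ ?_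
  · intro k hk
    simp only [Finset.mem_range, Finset.mem_Icc] at *
    omega
  · intro k hk
    simp only [Finset.mem_range, Finset.mem_Icc] at *
    omega
  · intro k hk
    simp
  · intro k hk
    simp only [Finset.mem_Icc] at *
    omega
  · intro k hk
    have hk' : k ≤ 2 * m := by simpa [Nat.lt_succ_iff] using hk
    rw [add_sub_cancel, Int.toNat_natCast]
    have hch (t : ℕ) : 2 * (t.choose 2 : ℤ) = t * (t - 1) := by
      induction t with
      | zero => simp
      | succ t ih =>
        rw [Nat.choose_succ_succ' t 1, Nat.choose_one_right]
        push_cast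
        linarith
    have e1 := two_mul_tri (k - m)
    have e2 := two_mul_tri (k - m - 1)
    have e3 := hch k
    have e4 := hch m
    obtain ⟨r, hr⟩ := Nat.exists_eq_add_of_le hk'
    have hr' : 2 * (m : ℤ) = k + r := by exact_mod_cast hr
    have hx' : k.choose 2 + k + m * (2 * m - k) = m + (m.choose 2 + m * m) + tri (k - m) := by
      rw [hr, Nat.add_sub_cancel_left]
      zify
      rw [show (r : ℤ) = 2 * m - k by linarith]
      linarith
    have hy' : k.choose 2 + m * (2 * m - k) = (m.choose 2 + m * m) + tri (k - m - 1) := by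
      rw [hr, Nat.add_sub_cancel_left]
      zify
      rw [show (r : ℤ) = 2 * m - k by linarith]
      linarith
    calc _ = gaussBinom (x * y) (2 * m) k * (x ^ (k.choose 2 + k + m * (2 * m - k)) *
          y ^ (k.choose 2 + m * (2 * m - k))) := by ring
      _ = _ := by rw [hx', hy']; ring

end GaussBinom

/-! ### Truncation and the Jacobi triple product -/

/-- Reduction of power series modulo `q ^ (N + 1)`. -/
noncomputable abbrev modXPow (N : ℕ) : ℤ⟦X⟧ →+* ℤ⟦X⟧ ⧸ Ideal.span {(X : ℤ⟦X⟧) ^ (N + 1)} :=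
  Ideal.Quotient.mk _

theorem modXPow_eq_iff {N : ℕ} {f g : ℤ⟦X⟧} :
    modXPow N f = modXPow N g ↔ ∀ k ≤ N, coeff k f = coeff k g := by
  rw [Ideal.Quotient.mk_eq_mk_iff_sub_mem, Ideal.mem_span_singleton, X_pow_dvd_iff]
  simp [sub_eq_zero]

theorem modXPow_eq_zero_of_dvd {N n : ℕ} {f : ℤ⟦X⟧} (hn : N < n) (h : X ^ n ∣ f) :
    modXPow N f = 0 := by
  rw [Ideal.Quotient.eq_zero_iff_mem, Ideal.mem_span_singleton]
  exact (pow_dvd_pow X hn).trans h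

theorem modXPow_prod_range {N m : ℕ} (a : ℤ⟦X⟧) {b : ℤ⟦X⟧} (hb : X ∣ b) (hm : N < m) :
    ∀ M ≥ m, modXPow N (∏ n ∈ Finset.range M, (1 - a * b ^ n)) =
      modXPow N (∏ n ∈ Finset.range m, (1 - a * b ^ n)) := by
  intro M hM
  induction M, hM using Nat.le_induction with
  | base => rfl
  | succ M hM ih =>
    have h : modXPow N (a * b ^ M) = 0 :=
      modXPow_eq_zero_of_dvd (hm.trans_le hM) ((pow_dvd_pow_of_dvd hb M).mul_left a)
    rw [Finset.prod_range_succ, map_mul, ih, map_sub, h]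
    simp

theorem tendsto_coeff_prod_range (a : ℤ⟦X⟧) {b : ℤ⟦X⟧} (hb : X ∣ b) (k : ℕ) :
    Filter.Tendsto (fun M => coeff k (∏ n ∈ Finset.range M, (1 - a * b ^ n))) Filter.atTop
      (nhds (coeff k (qPoch a b))) :=
  ((WithPiTopology.continuous_coeff ℤ k).tendsto _).comp
    (multipliable_qPoch a (X_dvd_iff.1 hb)).hasProd.tendsto_prod_nat

theorem modXPow_qPoch {N m : ℕ} (a : ℤ⟦X⟧) {b : ℤ⟦X⟧} (hb : X ∣ b) (hm : N < m) :
    modXPow N (qPoch a b) = modXPow N (∏ n ∈ Finset.range m, (1 - a * b ^ n)) := by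
  rw [modXPow_eq_iff]
  intro k hk
  refine tendsto_nhds_unique (tendsto_coeff_prod_range a hb k) ?_
  refine tendsto_const_nhds.congr' ?_
  filter_upwards [Filter.eventually_ge_atTop m] with M hM
  exact (modXPow_eq_iff.1 (modXPow_prod_range a hb hm M hM) k hk).symm

/-- The Jacobi triple product identity, modulo `q ^ (N + 1)`. -/
theorem modXPow_jacobi_triple {x y : ℤ⟦X⟧} (hx : x ≠ 0) (hy : y ≠ 0) (hxX : X ∣ x) (hyX : X ∣ y)
    (N : ℕ) :
    modXPow N (qPoch (-x) (x * y) * qPoch (-y) (x * y) * qPoch (x * y) (x * y)) =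
      modXPow N (∑ i ∈ Finset.Icc (-N : ℤ) N, x ^ tri i * y ^ tri (i - 1)) := by
  have hb : X ∣ x * y := hxX.mul_right y
  have hP {m : ℕ} (hm : N < m) := modXPow_qPoch (x * y) hb hm
  have hunit : IsUnit (modXPow N (qPoch (x * y) (x * y))) := by
    rw [hP N.lt_succ_self]
    refine IsUnit.map _ (PowerSeries.isUnit_iff_constantCoeff.2 ?_)
    have h0 : constantCoeff (x * y) = 0 := X_dvd_iff.1 hb
    simp only [map_prod, map_sub, map_one, map_mul _ (x * y), h0]
    simp
  -- Truncated form of the limit of the Gaussian binomial, $1/(b;b)_\infty$ with $b=xy$.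
  have hG {p r : ℕ} (hp : N < p) (hr : N < r) :
      modXPow N (qPoch (x * y) (x * y)) * modXPow N (gaussBinom (x * y) (p + r) p) = 1 := by
    have h := congrArg (modXPow N) (gaussBinom_mul_prod_mul_prod (x * y) p r)
    rw [map_mul, map_mul, ← hP hp, ← hP hr, ← hP (hp.trans_le (Nat.le_add_right p r))] at h
    apply hunit.mul_left_cancel
    linear_combination h
  -- Large enough that $m\pm i>N$ whenever $|i|\le N$, as `hG` requires.
  set m := 2 * N + 1 with hm
  have hfin := congrArg (modXPow N) (prod_mul_prod_eq_sum_gaussBinom hx hy m)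
  have hNm : N < m := by omega
  simp only [← sub_neg_eq_add (1 : ℤ⟦X⟧), ← neg_mul] at hfin
  rw [map_mul, ← modXPow_qPoch (-x) hb hNm, ← modXPow_qPoch (-y) hb hNm, ← map_mul] at hfin
  rw [map_mul, hfin, map_sum, map_sum, Finset.sum_mul]
  symm
  refine Finset.sum_subset_zero_on_sdiff (Finset.Icc_subset_Icc (by omega) (by omega)) ?_ ?_
  · intro i hi
    have hi' : N < i.natAbs := by
      simp only [Finset.mem_sdiff, Finset.mem_Icc] at hi
      omega
    -- Terms with $|i|>N$ vanish, being divisible by $X^{i^2}$.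
    have hd : (X : ℤ⟦X⟧) ^ (tri i + tri (i - 1)) ∣ x ^ tri i * y ^ tri (i - 1) := by
      rw [pow_add]
      exact mul_dvd_mul (pow_dvd_pow_of_dvd hxX _) (pow_dvd_pow_of_dvd hyX _)
    have hlt : N < tri i + tri (i - 1) := by
      zify
      have := tri_add_tri_sub_one i
      push_cast at this
      rw [this, ← Int.natAbs_sq]
      exact_mod_cast hi'.trans_le (Nat.le_self_pow two_ne_zero _)
    rw [map_mul, modXPow_eq_zero_of_dvd hlt hd, mul_zero, zero_mul]
  · intro i hi
    obtain ⟨p, r, hpr, hp, hN, hN'⟩ : ∃ p r : ℕ, 2 * m = p + r ∧ (m + i).toNat = p ∧ N < p ∧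
        N < r := by
      simp only [Finset.mem_Icc] at hi
      exact ⟨(m + i).toNat, (m - i).toNat, by omega, rfl, by omega, by omega⟩
    rw [hp, hpr, map_mul _ (gaussBinom _ _ _)]
    linear_combination (-modXPow N (x ^ tri i * y ^ tri (i - 1))) * hG hN hN'

/-! ### Theta series and their triple products -/

/-- The exponent `a i (i + 1) / 2 + c i (i - 1) / 2` of a term of Ramanujan's theta function. -/
def thetaExp (a c : ℕ) (i : ℤ) : ℕ := a * tri i + c * tri (i - 1)

theorem two_mul_thetaExp (a c : ℕ) (i : ℤ) :
    2 * (thetaExp a c i : ℤ) = (a + c) * i ^ 2 + (a - c) * i := by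
  have h1 := two_mul_tri i
  have h2 := two_mul_tri (i - 1)
  rw [thetaExp]
  push_cast
  linear_combination (a : ℤ) * h1 + c * h2

/-- Ensures that the box $[-N,N]^3$ contains every solution, so truncation loses none. -/
theorem natAbs_le_thetaExp {a c : ℕ} (ha : 0 < a) (hc : 0 < c) (i : ℤ) :
    i.natAbs ≤ thetaExp a c i := by
  have h := tri_add_tri_sub_one i
  rw [← Int.natAbs_sq] at h
  have h' : tri i + tri (i - 1) = i.natAbs ^ 2 := by exact_mod_cast h
  calc i.natAbs ≤ i.natAbs ^ 2 := Nat.le_self_pow two_ne_zero _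
    _ = tri i + tri (i - 1) := h'.symm
    _ ≤ thetaExp a c i :=
      Nat.add_le_add (Nat.le_mul_of_pos_left _ ha) (Nat.le_mul_of_pos_left _ hc)

theorem neg_one_pow_tri_add_tri (i : ℤ) :
    (-1 : ℤ) ^ (tri i + tri (i - 1)) = (i.negOnePow : ℤ) := by
  rw [← Int.coe_negOnePow_natCast, tri_add_tri_sub_one, pow_two, Int.negOnePow_mul_self]

theorem modXPow_theta {a c : ℕ} (ha : 0 < a) (hc : 0 < c) (N : ℕ) :
    modXPow N (qPoch₂ (-X ^ a) (-X ^ c) (X ^ (a + c)) * qPoch (X ^ (a + c)) (X ^ (a + c))) =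
      modXPow N (∑ i ∈ Finset.Icc (-N : ℤ) N, X ^ thetaExp a c i) := by
  have h := modXPow_jacobi_triple (pow_ne_zero a X_ne_zero) (pow_ne_zero c X_ne_zero)
    (dvd_pow_self X ha.ne') (dvd_pow_self X hc.ne') N
  simp only [← pow_mul, ← pow_add] at h
  exact h

theorem modXPow_alternating_theta {a c : ℕ} (ha : 0 < a) (hc : 0 < c) (N : ℕ) :
    modXPow N (qPoch₂ (X ^ a) (X ^ c) (X ^ (a + c)) * qPoch (X ^ (a + c)) (X ^ (a + c))) =
      modXPow N (∑ i ∈ Finset.Icc (-N : ℤ) N, C (i.negOnePow : ℤ) * X ^ thetaExp a c i) := by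
  have h := modXPow_jacobi_triple (neg_ne_zero.2 (pow_ne_zero a X_ne_zero))
    (neg_ne_zero.2 (pow_ne_zero c X_ne_zero))
    ((dvd_pow_self X ha.ne').neg_right) ((dvd_pow_self X hc.ne').neg_right) N
  rw [neg_mul_neg, ← pow_add, neg_neg, neg_neg] at h
  rw [qPoch₂, h]
  congr 1
  refine Finset.sum_congr rfl fun i _ => ?_
  rw [← neg_one_pow_tri_add_tri, neg_pow, neg_pow (X ^ c), thetaExp, map_pow, map_neg, map_one]
  ring

/-- The triples of indices in a product of three theta series contributing to `q ^ N`. -/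
noncomputable def thetaTriples (a c d e N : ℕ) : Finset (ℤ × ℤ × ℤ) :=
  {t ∈ Finset.Icc (-N : ℤ) N ×ˢ Finset.Icc (-N : ℤ) N ×ˢ Finset.Icc (-N : ℤ) N |
    thetaExp a c t.1 + thetaExp a c t.2.1 + thetaExp d e t.2.2 = N}

theorem mem_thetaTriples {a c d e N : ℕ} (ha : 0 < a) (hc : 0 < c) (hd : 0 < d) (he : 0 < e)
    {i j k : ℤ} : (i, j, k) ∈ thetaTriples a c d e N ↔
      (a + c) * (i ^ 2 + j ^ 2) + (a - c) * (i + j) + (d + e) * k ^ 2 + (d - e) * k = 2 * N := by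
  have h1 := natAbs_le_thetaExp ha hc i
  have h2 := natAbs_le_thetaExp ha hc j
  have h3 := natAbs_le_thetaExp hd he k
  have h4 : (a + c) * (i ^ 2 + j ^ 2) + (a - c) * (i + j) + (d + e) * k ^ 2 + (d - e) * k =
      2 * ((thetaExp a c i + thetaExp a c j + thetaExp d e k : ℕ) : ℤ) := by
    push_cast
    linear_combination -two_mul_thetaExp a c i - two_mul_thetaExp a c j - two_mul_thetaExp d e k
  rw [h4]
  simp only [thetaTriples, Finset.mem_filter, Finset.mem_product, Finset.mem_Icc]
  omega

theorem coeff_theta_sq_mul_alternating_theta {a c d e : ℕ} (ha : 0 < a) (hc : 0 < c) (hd : 0 < d)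
    (he : 0 < e) (N : ℕ) :
    coeff N (qPoch₂ (-X ^ a) (-X ^ c) (X ^ (a + c)) ^ 2 * qPoch₂ (X ^ d) (X ^ e) (X ^ (d + e)) *
      (qPoch (X ^ (a + c)) (X ^ (a + c)) ^ 2 * qPoch (X ^ (d + e)) (X ^ (d + e)))) =
    ∑ t ∈ thetaTriples a c d e N, (t.2.2.negOnePow : ℤ) := by
  have h : modXPow N (qPoch₂ (-X ^ a) (-X ^ c) (X ^ (a + c)) ^ 2 *
      qPoch₂ (X ^ d) (X ^ e) (X ^ (d + e)) *
      (qPoch (X ^ (a + c)) (X ^ (a + c)) ^ 2 * qPoch (X ^ (d + e)) (X ^ (d + e)))) =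
      modXPow N (∑ t ∈ Finset.Icc (-N : ℤ) N ×ˢ Finset.Icc (-N : ℤ) N ×ˢ Finset.Icc (-N : ℤ) N,
        C (t.2.2.negOnePow : ℤ) *
          X ^ (thetaExp a c t.1 + thetaExp a c t.2.1 + thetaExp d e t.2.2)) := by
    rw [show ∀ A D P Q : ℤ⟦X⟧, A ^ 2 * D * (P ^ 2 * Q) = (A * P) * ((A * P) * (D * Q)) from
      fun A D P Q => by ring, map_mul _ (_ * _), map_mul _ (_ * _) (_ * _), modXPow_theta ha hc,
      modXPow_alternating_theta hd he, ← map_mul, ← map_mul, Finset.sum_mul_sum,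
      ← Finset.sum_product', Finset.sum_mul_sum, ← Finset.sum_product']
    congr 1
    refine Finset.sum_congr rfl fun t _ => ?_
    ring
  rw [modXPow_eq_iff.1 h N le_rfl, map_sum, thetaTriples, Finset.sum_filter]
  refine Finset.sum_congr rfl fun t _ => ?_
  rw [coeff_C_mul, coeff_X_pow]
  simp [eq_comm]

/-! ### Dividing out a series in $q^p$ -/

/-- The power series in `q ^ p`. -/
def seriesInXPow (p : ℕ) : Submonoid ℤ⟦X⟧ where
  carrier := {f | ∀ m, ¬ p ∣ m → coeff m f = 0}
  one_mem' m hm := by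
    rw [coeff_one, if_neg]
    rintro rfl
    exact hm (dvd_zero p)
  mul_mem' {f g} hf hg m hm := by
    rw [coeff_mul]
    refine Finset.sum_eq_zero fun t ht => ?_
    rw [Finset.HasAntidiagonal.mem_antidiagonal] at ht
    by_cases h : p ∣ t.1
    · rw [hg t.2 fun h' => hm (ht ▸ dvd_add h h'), mul_zero]
    · rw [hf t.1 h, zero_mul]

theorem qPoch_mem_seriesInXPow {p d : ℕ} (hpd : p ∣ d) (hd : 0 < d) :
    qPoch (X ^ d) (X ^ d) ∈ seriesInXPow p := by
  intro m hm
  refine tendsto_nhds_unique (tendsto_coeff_prod_range _ (dvd_pow_self X hd.ne') m) ?_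
  refine tendsto_const_nhds.congr fun M => ?_
  refine ((seriesInXPow p).prod_mem (t := Finset.range M) (fun n _ => ?_) m hm).symm
  intro l hl
  have h0 : l ≠ 0 := by
    rintro rfl
    exact hl (dvd_zero p)
  have h1 : l ≠ d + d * n := by
    rintro rfl
    exact hl (dvd_add hpd (hpd.mul_right n))
  rw [← pow_mul, ← pow_add, map_sub, coeff_one, coeff_X_pow, if_neg h0, if_neg h1, sub_zero]

theorem constantCoeff_qPoch_self {d : ℕ} (hd : 0 < d) :
    constantCoeff (qPoch (X ^ d) (X ^ d)) = 1 := by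
  have h := modXPow_eq_iff.1 (modXPow_qPoch (X ^ d) (dvd_pow_self X hd.ne') zero_lt_one) 0 le_rfl
  simpa [hd.ne'] using h

/-- A progression on which the coefficients of `f * P` vanish is one on which those of `f` do. -/
theorem coeff_eq_zero_of_coeff_mul_eq_zero {p r : ℕ} (hr : r < p) {f P : ℤ⟦X⟧}
    (hP : P ∈ seriesInXPow p)
    (hP1 : constantCoeff P = 1) (h : ∀ n, coeff (p * n + r) (f * P) = 0) (n : ℕ) :
    coeff (p * n + r) f = 0 := by
  induction n using Nat.strong_induction_on with
  | _ n ih =>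
    -- Other terms pair an exponent of $P$ not divisible by $p$ with anything, or an earlier
    -- coefficient of $f$ in the same class.
    rw [← h n, coeff_mul, Finset.sum_eq_single (p * n + r, 0)]
    · simp [hP1]
    · rintro ⟨i, j⟩ hij hne
      rw [Finset.HasAntidiagonal.mem_antidiagonal] at hij
      by_cases hj : p ∣ j
      · obtain ⟨l, rfl⟩ := hj
        have hl0 : l ≠ 0 := by
          rintro rfl
          exact hne (by simpa using hij)
        have hln : l ≤ n := by
          by_contra! hlt
          have := Nat.mul_le_mul_left p (Nat.succ_le_of_lt hlt)
          rw [Nat.mul_succ] at this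
          omega
        obtain ⟨s, rfl⟩ := Nat.exists_eq_add_of_le hln
        obtain rfl : i = p * s + r := by
          rw [mul_add] at hij
          omega
        rw [ih s (by omega), zero_mul]
      · rw [hP j hj, mul_zero]
    · simp

/-! ### Isometries between the ellipsoids -/

/-- For $N=5n$ the first equation forces $i+j\equiv k\pmod 5$, exactly what makes the isometry
integral. Since $5k'=2i+2j+3k$, the parity of $k$ is kept. -/
theorem sum_thetaTriples_five_mul (n : ℕ) :
    ∑ t ∈ thetaTriples 1 4 4 6 (5 * n), (t.2.2.negOnePow : ℤ) =
      ∑ t ∈ thetaTriples 2 3 2 8 (5 * n), (t.2.2.negOnePow : ℤ) := by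
  refine Finset.sum_bij'
    (fun t _ => ((4 * t.1 - t.2.1 - 4 * t.2.2) / 5, (-t.1 + 4 * t.2.1 - 4 * t.2.2) / 5,
      (2 * t.1 + 2 * t.2.1 + 3 * t.2.2) / 5))
    (fun t _ => ((4 * t.1 - t.2.1 + 4 * t.2.2) / 5, (-t.1 + 4 * t.2.1 + 4 * t.2.2) / 5,
      (-2 * t.1 - 2 * t.2.1 + 3 * t.2.2) / 5)) ?_ ?_ ?_ ?_ ?_
  all_goals
    rintro ⟨i, j, k⟩ h
    rw [mem_thetaTriples (by norm_num) (by norm_num) (by norm_num) (by norm_num)] at h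
    push_cast at h
  · obtain ⟨i', hi⟩ : ∃ i', 4 * i - j - 4 * k = 5 * i' := ⟨(4 * i - j - 4 * k) / 5, by omega⟩
    obtain ⟨j', hj⟩ : ∃ j', -i + 4 * j - 4 * k = 5 * j' := ⟨(-i + 4 * j - 4 * k) / 5, by omega⟩
    obtain ⟨k', hk⟩ : ∃ k', 2 * i + 2 * j + 3 * k = 5 * k' := ⟨(2 * i + 2 * j + 3 * k) / 5, by omega⟩
    simp only [hi, hj, hk, Int.mul_ediv_cancel_left _ (by norm_num : (5 : ℤ) ≠ 0)]
    rw [mem_thetaTriples (by norm_num) (by norm_num) (by norm_num) (by norm_num)]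
    apply mul_left_cancel₀ (by norm_num : (25 : ℤ) ≠ 0)
    push_cast
    -- Each multiplier is a divided difference: for $5A^2-5A$ in the first two coordinates and
    -- $10A^2-30A$ in the third, with $A=5i'$, $5j'$, $5k'$.
    linear_combination 25 * h - 5 * (5 * i' + (4 * i - j - 4 * k) + (-1)) * hi -
      5 * (5 * j' + (-i + 4 * j - 4 * k) + (-1)) * hj - 5 * (2 * (5 * k' + (2 * i + 2 * j + 3 * k)) + (-6)) * hk
  · obtain ⟨i', hi⟩ : ∃ i', 4 * i - j + 4 * k = 5 * i' := ⟨(4 * i - j + 4 * k) / 5, by omega⟩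
    obtain ⟨j', hj⟩ : ∃ j', -i + 4 * j + 4 * k = 5 * j' := ⟨(-i + 4 * j + 4 * k) / 5, by omega⟩
    obtain ⟨k', hk⟩ : ∃ k', -2 * i - 2 * j + 3 * k = 5 * k' := ⟨(-2 * i - 2 * j + 3 * k) / 5, by omega⟩
    simp only [hi, hj, hk, Int.mul_ediv_cancel_left _ (by norm_num : (5 : ℤ) ≠ 0)]
    rw [mem_thetaTriples (by norm_num) (by norm_num) (by norm_num) (by norm_num)]
    apply mul_left_cancel₀ (by norm_num : (25 : ℤ) ≠ 0)
    push_cast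
    linear_combination 25 * h - 5 * (5 * i' + (4 * i - j + 4 * k) + (-3)) * hi -
      5 * (5 * j' + (-i + 4 * j + 4 * k) + (-3)) * hj - 5 * (2 * (5 * k' + (-2 * i - 2 * j + 3 * k)) + (-2)) * hk
  · ext <;> dsimp only <;> omega
  · ext <;> dsimp only <;> omega
  · rw [Units.val_inj, Int.negOnePow_eq_iff, Int.even_iff]
    dsimp only
    omega

/-- Here $i+j\equiv k-1\pmod 5$. The previous isometry is followed by reflection in the target
centre, whence the shifts $1/5$ and $3/5$; now $5k'=3-2i-2j-3k$ flips the parity of $k$. -/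
theorem sum_thetaTriples_five_mul_add_four (n : ℕ) :
    ∑ t ∈ thetaTriples 1 4 4 6 (5 * n + 4), (t.2.2.negOnePow : ℤ) =
      -∑ t ∈ thetaTriples 2 3 2 8 (5 * n + 4), (t.2.2.negOnePow : ℤ) := by
  rw [← Finset.sum_neg_distrib]
  refine Finset.sum_bij'
    (fun t _ => ((-4 * t.1 + t.2.1 + 4 * t.2.2 + 1) / 5, (t.1 - 4 * t.2.1 + 4 * t.2.2 + 1) / 5,
      (-2 * t.1 - 2 * t.2.1 - 3 * t.2.2 + 3) / 5))
    (fun t _ => ((-4 * t.1 + t.2.1 - 4 * t.2.2 + 3) / 5, (t.1 - 4 * t.2.1 - 4 * t.2.2 + 3) / 5,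
      (2 * t.1 + 2 * t.2.1 - 3 * t.2.2 + 1) / 5)) ?_ ?_ ?_ ?_ ?_
  all_goals
    rintro ⟨i, j, k⟩ h
    rw [mem_thetaTriples (by norm_num) (by norm_num) (by norm_num) (by norm_num)] at h
    push_cast at h
  · obtain ⟨i', hi⟩ : ∃ i', -4 * i + j + 4 * k + 1 = 5 * i' := ⟨(-4 * i + j + 4 * k + 1) / 5, by omega⟩
    obtain ⟨j', hj⟩ : ∃ j', i - 4 * j + 4 * k + 1 = 5 * j' := ⟨(i - 4 * j + 4 * k + 1) / 5, by omega⟩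
    obtain ⟨k', hk⟩ : ∃ k', -2 * i - 2 * j - 3 * k + 3 = 5 * k' := ⟨(-2 * i - 2 * j - 3 * k + 3) / 5, by omega⟩
    simp only [hi, hj, hk, Int.mul_ediv_cancel_left _ (by norm_num : (5 : ℤ) ≠ 0)]
    rw [mem_thetaTriples (by norm_num) (by norm_num) (by norm_num) (by norm_num)]
    apply mul_left_cancel₀ (by norm_num : (25 : ℤ) ≠ 0)
    push_cast
    linear_combination 25 * h - 5 * (5 * i' + (-4 * i + j + 4 * k + 1) + (-1)) * hi -
      5 * (5 * j' + (i - 4 * j + 4 * k + 1) + (-1)) * hj - 5 * (2 * (5 * k' + (-2 * i - 2 * j - 3 * k + 3)) + (-6)) * hk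
  · obtain ⟨i', hi⟩ : ∃ i', -4 * i + j - 4 * k + 3 = 5 * i' := ⟨(-4 * i + j - 4 * k + 3) / 5, by omega⟩
    obtain ⟨j', hj⟩ : ∃ j', i - 4 * j - 4 * k + 3 = 5 * j' := ⟨(i - 4 * j - 4 * k + 3) / 5, by omega⟩
    obtain ⟨k', hk⟩ : ∃ k', 2 * i + 2 * j - 3 * k + 1 = 5 * k' := ⟨(2 * i + 2 * j - 3 * k + 1) / 5, by omega⟩
    simp only [hi, hj, hk, Int.mul_ediv_cancel_left _ (by norm_num : (5 : ℤ) ≠ 0)]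
    rw [mem_thetaTriples (by norm_num) (by norm_num) (by norm_num) (by norm_num)]
    apply mul_left_cancel₀ (by norm_num : (25 : ℤ) ≠ 0)
    push_cast
    linear_combination 25 * h - 5 * (5 * i' + (-4 * i + j - 4 * k + 3) + (-3)) * hi -
      5 * (5 * j' + (i - 4 * j - 4 * k + 3) + (-3)) * hj - 5 * (2 * (5 * k' + (2 * i + 2 * j - 3 * k + 1)) + (-2)) * hk
  · ext <;> dsimp only <;> omega
  · ext <;> dsimp only <;> omega
  · rw [← Units.val_neg, ← Int.negOnePow_succ, Units.val_inj, Int.negOnePow_eq_iff, Int.even_iff]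
    dsimp only
    omega

/-! ### Specialisation to $g_1$ and $h_1$ -/

/-- The common denominator `(q⁵; q⁵)_∞² (q¹⁰; q¹⁰)_∞`. -/
noncomputable def thetaDenom : ℤ⟦X⟧ :=
  qPoch (X ^ 5) (X ^ 5) ^ 2 * qPoch (X ^ 10) (X ^ 10)

theorem thetaDenom_mem : thetaDenom ∈ seriesInXPow 5 :=
  mul_mem (pow_mem (qPoch_mem_seriesInXPow (by norm_num) (by norm_num)) 2)
    (qPoch_mem_seriesInXPow (by norm_num) (by norm_num))

theorem constantCoeff_thetaDenom : constantCoeff thetaDenom = 1 := by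
  simp [thetaDenom, constantCoeff_qPoch_self]

theorem mk_g₁ : PowerSeries.mk g₁ =
    qPoch₂ (-X) (-X ^ 4) (X ^ 5) ^ 2 * qPoch₂ (X ^ 4) (X ^ 6) (X ^ 10) :=
  PowerSeries.ext fun n => coeff_mk n g₁

theorem mk_h₁ : PowerSeries.mk h₁ =
    qPoch₂ (-X ^ 2) (-X ^ 3) (X ^ 5) ^ 2 * qPoch₂ (X ^ 2) (X ^ 8) (X ^ 10) :=
  PowerSeries.ext fun n => coeff_mk n h₁

theorem coeff_mk_g₁_mul_thetaDenom (N : ℕ) :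
    coeff N (PowerSeries.mk g₁ * thetaDenom) =
      ∑ t ∈ thetaTriples 1 4 4 6 N, (t.2.2.negOnePow : ℤ) := by
  have h := coeff_theta_sq_mul_alternating_theta (a := 1) (c := 4) (d := 4) (e := 6)
    (by norm_num) (by norm_num) (by norm_num) (by norm_num) N
  rw [pow_one] at h
  rw [mk_g₁]
  exact h

theorem coeff_mk_h₁_mul_thetaDenom (N : ℕ) :
    coeff N (PowerSeries.mk h₁ * thetaDenom) =
      ∑ t ∈ thetaTriples 2 3 2 8 N, (t.2.2.negOnePow : ℤ) := by
  rw [mk_h₁]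
  exact coeff_theta_sq_mul_alternating_theta (a := 2) (c := 3) (d := 2) (e := 8)
    (by norm_num) (by norm_num) (by norm_num) (by norm_num) N

end QSeries

theorem mainTheorem7 (n : ℕ) :
    QSeries.g₁ (5 * n) = QSeries.h₁ (5 * n) ∧
      QSeries.g₁ (5 * n + 4) = -QSeries.h₁ (5 * n + 4) := by
  open QSeries in
  constructor
  · have h := coeff_eq_zero_of_coeff_mul_eq_zero (r := 0) (by norm_num) thetaDenom_mem
      constantCoeff_thetaDenom (f := PowerSeries.mk g₁ - PowerSeries.mk h₁) (fun m => by
        rw [sub_mul, map_sub, coeff_mk_g₁_mul_thetaDenom, coeff_mk_h₁_mul_thetaDenom, add_zero,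
          sum_thetaTriples_five_mul, sub_self]) n
    simpa [sub_eq_zero] using h
  · have h := coeff_eq_zero_of_coeff_mul_eq_zero (r := 4) (by norm_num) thetaDenom_mem
      constantCoeff_thetaDenom (f := PowerSeries.mk g₁ + PowerSeries.mk h₁) (fun m => by
        rw [add_mul, map_add, coeff_mk_g₁_mul_thetaDenom, coeff_mk_h₁_mul_thetaDenom,
          sum_thetaTriples_five_mul_add_four, neg_add_cancel]) n
    simpa [add_eq_zero_iff_eq_neg] using h
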